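/- Let $K$ be a field, let $m,n,r\ge 1$ be integers, let $X_k=(x_{ij}^k)$, $1\le k\le r$, be $m\times n$ matrices of distinct indeterminates, and let $R=K[x_{ij}^k]$ be the polynomial ring in these $mnr$ indeterminates. Let $H=(X_1\,\cdots\,X_r)$ be the horizontal concatenation and $V$ the vertical concatenation (with $X_1$ on top) of $X_1,\dots,X_r$, and let $I_{mn}^r\subseteq R$ be the ideal generated by all $2$-minors of $H$ and all $2$-minors of $V$. Fix a term order on $R$ that is diagonal, i.e. the leading term of every $2$-minor of $H$ and of $V$ is the product of the entries on its main diagonal, and let $\operatorname{in}(I_{mn}^r)$ be the initial ideal. Identify $x_{ij}^k$ with the lattice point $(i,(k-1)n+j)$ of $\mathcal P=\{(i,j): 1\le i\le m,\ 1\le j\le nr\}$. A path $p\longrightarrow q$ is a set of points $\{p_1,\dots,p_t\}$, $t\ge1$, with $p_1=p$, $p_t=q$ and $p_{s+1}-p_s\in\{(-1,0),(0,1)\}$ for $1\le s<t$; a single point is thus a path. There is exactly one simplicial complex $\Delta$ on $\mathcal P$ whose Stanley–Reisner ideal $I_\Delta$ (generated by the squarefree monomials supported on the non-faces) equals $\operatorname{in}(I_{mn}^r)$.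 A set $F$ is a facet (an inclusion-maximal face) of $\Delta$ if and only if $F$ is the union of $r$ paths $$(g_{k-1},(k-1)n+h_k)\longrightarrow(g_k,(k-1)n+h_{k-1}),\qquad 1\le k\le r,$$ for some integers $m=g_0\ge g_1\ge\cdots\ge g_r=1$ and $n=h_0\ge h_1\ge\cdots\ge h_r=1$. In particular, every facet of $\Delta$ has exactly $m+n+r-2$ elements, so $\Delta$ is pure. -/

import Mathlib

namespace DoubleDet

open MvPolynomial

/-- The index set of the indeterminates: `(i, j, k)` is the index of the `(i, j)` entry of the
`k`-th generic matrix (all indices are counted from `0` here). -/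
abbrev Var (m n r : ℕ) : Type := Fin m × Fin n × Fin r

/-- The horizontal concatenation `(X_1 ⋯ X_r)`; a column is a pair (block, column of the block),
ordered lexicographically. -/
noncomputable def horizontal (K : Type*) [Field K] (m n r : ℕ) :
    Matrix (Fin m) (Fin r ×ₗ Fin n) (MvPolynomial (Var m n r) K) :=
  Matrix.of fun i c => X (i, (ofLex c).2, (ofLex c).1)

/-- The vertical concatenation of `X_1, …, X_r`; a row is a pair (block, row of the block),
ordered lexicographically. -/
noncomputable def vertical (K : Type*) [Field K] (m n r : ℕ) :
    Matrix (Fin r ×ₗ Fin m) (Fin n) (MvPolynomial (Var m n r) K) :=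
  Matrix.of fun a j => X ((ofLex a).2, j, (ofLex a).1)

/-- The set of all `2`-minors of a matrix. -/
def twoMinors {α β S : Type*} [LinearOrder α] [LinearOrder β] [CommRing S] (A : Matrix α β S) :
    Set S :=
  {f | ∃ (a a' : α) (b b' : β), a < a' ∧ b < b' ∧ f = (A.submatrix ![a, a'] ![b, b']).det}

/-- The double determinantal ideal generated by the `2`-minors of both concatenations. -/
noncomputable def doubleDetIdeal (K : Type*) [Field K] (m n r : ℕ) :
    Ideal (MvPolynomial (Var m n r) K) :=
  Ideal.span (twoMinors (horizontal K m n r) ∪ twoMinors (vertical K m n r))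

/-- The leading term of every `2`-minor of `A` is the product of its main diagonal. -/
def LeadsOnDiagonals {σ α β K : Type*} [LinearOrder α] [LinearOrder β] [Field K]
    (ord : MonomialOrder σ) (A : Matrix α β (MvPolynomial σ K)) : Prop :=
  ∀ (a a' : α) (b b' : β), a < a' → b < b' →
    ord.leadingTerm (A.submatrix ![a, a'] ![b, b']).det = A a b * A a' b'

/-- Diagonal term orders. -/
def IsDiagonal (K : Type*) [Field K] {m n r : ℕ} (ord : MonomialOrder (Var m n r)) : Prop :=
  LeadsOnDiagonals ord (horizontal K m n r) ∧ LeadsOnDiagonals ord (vertical K m n r)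

/-- The initial ideal of `I` with respect to a term order. -/
noncomputable def initialIdeal {σ K : Type*} [Field K] (ord : MonomialOrder σ)
    (I : Ideal (MvPolynomial σ K)) : Ideal (MvPolynomial σ K) :=
  Ideal.span (ord.leadingTerm '' (I : Set (MvPolynomial σ K)))

/-- The Stanley–Reisner ideal, generated by the squarefree monomials supported on the non-faces.
Mathlib's complexes list the nonempty faces only; the empty set always counts as a face. -/
noncomputable def stanleyReisnerIdeal {σ : Type*} (K : Type*) [Field K]
    (D : PreAbstractSimplicialComplex σ) : Ideal (MvPolynomial σ K) :=
  Ideal.span {f | ∃ s : Finset σ, s.Nonempty ∧ s ∉ D.faces ∧ f = ∏ v ∈ s, X v}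

/-- Facets are the inclusion-maximal faces. -/
def IsFacet {σ : Type*} (D : PreAbstractSimplicialComplex σ) (F : Finset σ) : Prop :=
  Maximal (fun s => s ∈ D.faces) F

/-- The identification of the indeterminates with the lattice points `(i, j)`, `1 ≤ i ≤ m`,
`1 ≤ j ≤ n * r`: in indices counted from `1`, it sends `x_{ij}^k` to `(i, (k - 1) * n + j)`. -/
def point {m n r : ℕ} (v : Var m n r) : ℕ × ℕ :=
  ((v.1 : ℕ) + 1, (v.2.2 : ℕ) * n + ((v.2.1 : ℕ) + 1))

/-- One step of a path: `q - p` is `(-1, 0)` or `(0, 1)`. -/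
def Step (p q : ℕ × ℕ) : Prop :=
  (q.1 + 1 = p.1 ∧ q.2 = p.2) ∨ (q.1 = p.1 ∧ q.2 = p.2 + 1)

/-- `S` is (the set of points of) a path `p ⟶ q`; a single point is a path. -/
def IsPath (p q : ℕ × ℕ) (S : Finset (ℕ × ℕ)) : Prop :=
  ∃ l : List (ℕ × ℕ), l.head? = some p ∧ l.getLast? = some q ∧ l.IsChain Step ∧ S = l.toFinset

/-- `F` is a union of `r` paths
`(g_{k-1}, (k-1) n + h_k) ⟶ (g_k, (k-1) n + h_{k-1})`, `k = 1, …, r`, for some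
`m = g_0 ≥ ⋯ ≥ g_r = 1` and `n = h_0 ≥ ⋯ ≥ h_r = 1`.
The variable `k` below is the `k - 1` of this formula. -/
def IsUnionOfPaths (m n r : ℕ) (F : Finset (ℕ × ℕ)) : Prop :=
  ∃ g h : Fin (r + 1) → ℕ,
    Antitone g ∧ g 0 = m ∧ g (Fin.last r) = 1 ∧
    Antitone h ∧ h 0 = n ∧ h (Fin.last r) = 1 ∧
    ∃ S : Fin r → Finset (ℕ × ℕ),
      (∀ k : Fin r, IsPath (g k.castSucc, (k : ℕ) * n + h k.succ)
        (g k.succ, (k : ℕ) * n + h k.castSucc) (S k)) ∧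
      F = Finset.univ.biUnion S

end DoubleDet

namespace DoubleDet

open MvPolynomial

/-! Call two variables a diagonal pair if their product is the main diagonal of a 2-minor. These
products lie in the initial ideal, and they generate it. Indeed, divide an element of the ideal by
elements led by diagonal pairs. The remainder has only diagonal-free monomials and is killed by the
Segre map x_ij^k ↦ a_i b_j c_k. That map is injective on such polynomials
(`eq_zero_of_segreHom_eq_zero`), because a diagonal-free exponent is determined by its marginals
(`eq_of_marginals_eq`). Hence Δ is the complex of diagonal-free sets.

In a diagonal-free set, rows and columns weakly decrease from block to block, and each block is a
chain for `PathLE`; so corners g, h exist and paths can be drawn through the set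
(`exists_isUnionOfPaths_superset`). Conversely, unions of paths are diagonal-free and all have m + n
+ r - 2 points, so none properly contains another: they are the facets. -/

/-! ### Lattice paths and chains -/

theorem IsPath.singleton (p : ℕ × ℕ) : IsPath p p {p} :=
  ⟨[p], by simp, by simp, by simp, by simp⟩

theorem IsPath.cons {p p' q : ℕ × ℕ} {S : Finset (ℕ × ℕ)} (hp : Step p p') (h : IsPath p' q S) :
    IsPath p q (insert p S) := by
  obtain ⟨l, h1, h2, h3, rfl⟩ := h
  cases l with
  | nil => simp at h1
  | cons a l =>
    simp only [List.head?_cons, Option.some.injEq] at h1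
    subst h1
    exact ⟨p :: a :: l, by simp, by simpa using h2, by simpa using ⟨hp, h3⟩, by simp⟩

theorem IsPath.rec_on {q : ℕ × ℕ} {P : ℕ × ℕ → Finset (ℕ × ℕ) → Prop} (base : P q {q})
    (step : ∀ p p' S, Step p p' → P p' S → P p (insert p S)) {p : ℕ × ℕ} {S : Finset (ℕ × ℕ)}
    (h : IsPath p q S) : P p S := by
  obtain ⟨l, h1, h2, h3, rfl⟩ := h
  induction l generalizing p with
  | nil => simp at h1
  | cons a l ih =>
    simp only [List.head?_cons, Option.some.injEq] at h1
    subst h1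
    cases l with
    | nil =>
      simp only [List.getLast?_singleton, Option.some.injEq] at h2
      subst h2
      simpa using base
    | cons b l =>
      rw [List.isChain_cons_cons] at h3
      rw [List.toFinset_cons]
      exact step _ b _ h3.1 (ih (by simp) (by simpa using h2) h3.2)

/-- The weak order in which a path traverses its points. -/
def PathLE (x y : ℕ × ℕ) : Prop := y.1 ≤ x.1 ∧ x.2 ≤ y.2

/-- Every step raises column minus row by one, so no point repeats and the endpoints fix the
cardinality; the count is stated without subtraction. -/
theorem IsPath.structure {p q : ℕ × ℕ} {S : Finset (ℕ × ℕ)} (h : IsPath p q S) :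
    p ∈ S ∧ (∀ x ∈ S, PathLE p x ∧ PathLE x q) ∧ (∀ x ∈ S, ∀ y ∈ S, PathLE x y ∨ PathLE y x) ∧
      S.card + p.2 + q.1 = p.1 + q.2 + 1 := by
  refine IsPath.rec_on (P := fun p S => p ∈ S ∧ (∀ x ∈ S, PathLE p x ∧ PathLE x q) ∧
      (∀ x ∈ S, ∀ y ∈ S, PathLE x y ∨ PathLE y x) ∧ S.card + p.2 + q.1 = p.1 + q.2 + 1) ?_ ?_ h
  · simp [PathLE]; omega
  · intro p p' S hs ih
    obtain ⟨h0, h1, h2, h3⟩ := ih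
    have key : ∀ x ∈ S, PathLE p x ∧ x ≠ p := by
      intro x hx
      have := (h1 x hx).1
      refine ⟨?_, ?_⟩
      · simp only [PathLE, Step] at *; omega
      · rintro rfl
        simp only [PathLE, Step] at *; omega
    have hp : p ∉ S := fun hp => (key p hp).2 rfl
    refine ⟨by simp, ?_, ?_, ?_⟩
    · have hq := (h1 p' h0).2
      have := (key p' h0).1
      intro x hx
      rcases Finset.mem_insert.1 hx with rfl | hx
      · simp only [PathLE] at *; omega
      · exact ⟨(key x hx).1, (h1 x hx).2⟩
    · intro x hx y hy
      rcases Finset.mem_insert.1 hx with hx' | hx' <;> rcases Finset.mem_insert.1 hy with hy' | hy'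
      · simp [PathLE, hx', hy']
      · exact Or.inl (hx' ▸ (key y hy').1)
      · exact Or.inr (hy' ▸ (key x hx').1)
      · exact h2 x hx' y hy'
    · rw [Finset.card_insert_of_notMem hp]
      have := (h1 p' h0).2
      simp only [PathLE, Step] at *; omega

/-- Every chain in a rectangle extends to a path between opposite corners. -/
theorem exists_isPath_superset (N : ℕ) {p q : ℕ × ℕ} (hpq : PathLE p q) (S : Finset (ℕ × ℕ))
    (hN : p.1 + q.2 = q.1 + p.2 + N) (hS : ∀ x ∈ S, PathLE p x ∧ PathLE x q)
    (hc : ∀ x ∈ S, ∀ y ∈ S, PathLE x y ∨ PathLE y x) : ∃ T, IsPath p q T ∧ S ⊆ T := by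
  induction N generalizing p S with
  | zero =>
    obtain rfl : p = q := by
      simp only [PathLE] at *; ext <;> omega
    refine ⟨{p}, .singleton p, fun x hx => ?_⟩
    have := hS x hx
    simp only [PathLE] at *
    rw [Finset.mem_singleton]
    ext <;> omega
  | succ N ih =>
    have main : ∀ p', Step p p' → PathLE p' q → (∀ x ∈ S.erase p, PathLE p' x) →
        ∃ T, IsPath p q T ∧ S ⊆ T := by
      intro p' hp' hq hle
      obtain ⟨T, hT, hST⟩ := ih hq (S.erase p)
        (by simp only [PathLE, Step] at *; omega)
        (fun x hx => ⟨hle x hx, (hS x (Finset.mem_of_mem_erase hx)).2⟩)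
        (fun x hx y hy => hc x (Finset.mem_of_mem_erase hx) y (Finset.mem_of_mem_erase hy))
      exact ⟨insert p T, hT.cons hp', fun x hx => by
        by_cases hxp : x = p
        · simp [hxp]
        · exact Finset.mem_insert_of_mem (hST (Finset.mem_erase.2 ⟨hxp, hx⟩))⟩
    have hne : ∀ x ∈ S.erase p, PathLE p x ∧ PathLE x q ∧ (x.1 ≠ p.1 ∨ x.2 ≠ p.2) := by
      intro x hx
      obtain ⟨hxp, hx⟩ := Finset.mem_erase.1 hx
      refine ⟨(hS x hx).1, (hS x hx).2, ?_⟩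
      by_contra! h
      exact hxp (Prod.ext h.1 h.2)
    -- Step up while all other chain points lie in rows above `p`. Otherwise one of them shares the
    -- row of `p`, or `q` does, and comparability puts all the others strictly to the right.
    by_cases hup : q.1 < p.1 ∧ ∀ x ∈ S.erase p, x.1 < p.1
    · refine main (p.1 - 1, p.2) (Or.inl ⟨by simp; omega, rfl⟩)
        (by simp only [PathLE] at *; omega) fun x hx => ?_
      have := hup.2 x hx
      have := hne x hx
      simp only [PathLE] at *; omega
    · have hright : p.2 < q.2 ∧ ∀ x ∈ S.erase p, p.2 < x.2 := by
        by_cases hq : q.1 < p.1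
        · simp only [hq, true_and, not_forall, not_lt] at hup
          obtain ⟨y, hy, hyp⟩ := hup
          have h1 := hne y hy
          refine ⟨by simp only [PathLE] at *; omega, fun x hx => ?_⟩
          have h2 := hne x hx
          have h3 := hc x (Finset.mem_of_mem_erase hx) y (Finset.mem_of_mem_erase hy)
          simp only [PathLE] at *; omega
        · refine ⟨by simp only [PathLE] at *; omega, fun x hx => ?_⟩
          have h2 := hne x hx
          simp only [PathLE] at *; omega
      refine main (p.1, p.2 + 1) (Or.inr ⟨rfl, rfl⟩)
        (by simp only [PathLE] at *; omega) fun x hx => ?_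
      have := hright.2 x hx
      have := hne x hx
      simp only [PathLE] at *; omega

/-! ### Diagonal-free sets and unions of paths -/

theorem point_mem_block {m n r : ℕ} {v : Var m n r} {k : ℕ} (h1 : k * n + 1 ≤ (point v).2)
    (h2 : (point v).2 ≤ k * n + n) : (v.2.2 : ℕ) = k := by
  simp only [point] at h1 h2
  rcases lt_trichotomy (v.2.2 : ℕ) k with hlt | heq | hlt
  · have := Nat.mul_le_mul_right n hlt
    rw [Nat.succ_mul] at this
    omega
  · exact heq
  · have := Nat.mul_le_mul_right n hlt
    rw [Nat.succ_mul] at this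
    omega

/-- `x_v x_w` is the main diagonal of a `2`-minor of the horizontal or vertical concatenation. -/
def IsDiagonalPair {m n r : ℕ} (v w : Var m n r) : Prop :=
  (v.1 < w.1 ∧ toLex (v.2.2, v.2.1) < toLex (w.2.2, w.2.1)) ∨
    (v.2.1 < w.2.1 ∧ toLex (v.2.2, v.1) < toLex (w.2.2, w.1))

/-- Separates the two roles: the first clause forces corners to decrease between blocks, the second
makes each block a chain. -/
theorem isDiagonalPair_iff {m n r : ℕ} (v w : Var m n r) :
    IsDiagonalPair v w ↔ (v.2.2 < w.2.2 ∧ (v.1 < w.1 ∨ v.2.1 < w.2.1)) ∨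
      (v.2.2 = w.2.2 ∧ v.1 < w.1 ∧ v.2.1 < w.2.1) := by
  simp only [IsDiagonalPair, Prod.Lex.toLex_lt_toLex]
  tauto

/-- A union of paths as in `IsUnionOfPaths` has `m + n + r - 2` points. -/
theorem IsUnionOfPaths.card {m n r : ℕ} {F : Finset (ℕ × ℕ)} (hF : IsUnionOfPaths m n r F) :
    F.card = m + n + r - 2 := by
  obtain ⟨g, h, hg, hg0, hg1, hh, hh0, hh1, S, hS, rfl⟩ := hF
  have hcard : ∀ k, (S k).card + h k.succ + g k.succ = g k.castSucc + h k.castSucc + 1 := by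
    intro k
    have := (hS k).structure.2.2.2
    simp only at this
    omega
  -- Since `1 ≤ h ≤ n`, the paths lie in disjoint column strips.
  have hdisj : (↑(Finset.univ : Finset (Fin r)) : Set (Fin r)).PairwiseDisjoint S := by
    have hlt : ∀ k k' : Fin r, k < k' → Disjoint (S k) (S k') := by
      intro k k' hkk
      rw [Finset.disjoint_left]
      intro x hx hx'
      have h1 := ((hS k).structure.2.1 x hx).2.2
      have h2 := ((hS k').structure.2.1 x hx').1.2
      have h3 : h k.castSucc ≤ n := hh0 ▸ hh (Fin.zero_le _)
      have h4 : 1 ≤ h k'.succ := hh1 ▸ hh (Fin.le_last _)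
      have := Nat.mul_le_mul_right n (show (k : ℕ) + 1 ≤ k' from hkk)
      rw [Nat.succ_mul] at this
      simp only at h1 h2
      omega
    intro k _ k' _ hkk
    rcases lt_or_gt_of_ne hkk with h1 | h1
    · exact hlt _ _ h1
    · exact (hlt _ _ h1).symm
  rw [Finset.card_biUnion fun k hk k' hk' hne => hdisj hk hk' hne]
  have hsum := Finset.sum_congr (rfl : (Finset.univ : Finset (Fin r)) = _) fun k _ => hcard k
  simp only [Finset.sum_add_distrib, Finset.sum_const, Finset.card_univ, Fintype.card_fin,
    smul_eq_mul, mul_one] at hsum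
  -- Splitting off the first or the last term makes the sums over the corners telescope.
  have e1 := (Fin.sum_univ_succ g).symm.trans (Fin.sum_univ_castSucc g)
  have e2 := (Fin.sum_univ_succ h).symm.trans (Fin.sum_univ_castSucc h)
  omega

theorem IsUnionOfPaths.exists_image {m n r : ℕ} (hr : 0 < r) {F : Finset (ℕ × ℕ)}
    (hF : IsUnionOfPaths m n r F) :
    ∃ s : Finset (Var m n r), s.Nonempty ∧ (∀ v ∈ s, ∀ w ∈ s, ¬ IsDiagonalPair v w) ∧
      s.image point = F := by
  obtain ⟨g, h, hg, hg0, hg1, hh, hh0, hh1, S, hS, rfl⟩ := hF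
  have hgm : ∀ k, 1 ≤ g k ∧ g k ≤ m := fun k => ⟨hg1 ▸ hg (Fin.le_last _), hg0 ▸ hg (Fin.zero_le _)⟩
  have hhn : ∀ k, 1 ≤ h k ∧ h k ≤ n := fun k => ⟨hh1 ▸ hh (Fin.le_last _), hh0 ▸ hh (Fin.zero_le _)⟩
  have hbd : ∀ k, ∀ x ∈ S k, g k.succ ≤ x.1 ∧ x.1 ≤ g k.castSucc ∧
      (k : ℕ) * n + h k.succ ≤ x.2 ∧ x.2 ≤ (k : ℕ) * n + h k.castSucc := by
    intro k x hx
    have := (hS k).structure.2.1 x hx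
    simp only [PathLE] at this
    omega
  have himage : (Finset.univ.filter fun v : Var m n r => point v ∈ Finset.univ.biUnion S).image
      point = Finset.univ.biUnion S := by
    ext x
    simp only [Finset.mem_image, Finset.mem_filter, Finset.mem_univ, true_and]
    refine ⟨by rintro ⟨v, hv, rfl⟩; exact hv, fun hx => ?_⟩
    obtain ⟨k, -, hk⟩ := Finset.mem_biUnion.1 hx
    have h1 := hbd k x hk
    have h2 := hgm k.succ
    have h3 := hgm k.castSucc
    have h4 := hhn k.succ
    have h5 := hhn k.castSucc
    have hpt : point ((⟨x.1 - 1, by omega⟩, ⟨x.2 - k * n - 1, by omega⟩, k) : Var m n r) = x := by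
      ext <;> simp only [point] <;> omega
    exact ⟨_, hpt.symm ▸ hx, hpt⟩
  refine ⟨_, ?_, ?_, himage⟩
  · rw [← Finset.image_nonempty (f := point), himage]
    exact ⟨_, Finset.mem_biUnion.2 ⟨⟨0, hr⟩, Finset.mem_univ _, (hS ⟨0, hr⟩).structure.1⟩⟩
  · have hblock : ∀ v : Var m n r, point v ∈ Finset.univ.biUnion S → point v ∈ S v.2.2 := by
      intro v hv
      obtain ⟨k, -, hk⟩ := Finset.mem_biUnion.1 hv
      have h1 := hbd k _ hk
      have h4 := hhn k.succ
      have h5 := hhn k.castSucc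
      have : v.2.2 = k := Fin.ext (point_mem_block (by omega) (by omega))
      rwa [this]
    intro v hv w hw
    replace hv := hblock v (Finset.mem_filter.1 hv).2
    replace hw := hblock w (Finset.mem_filter.1 hw).2
    rw [isDiagonalPair_iff]
    rintro (⟨hk, hb⟩ | ⟨hk, hb1, hb2⟩)
    · have h1 := hbd _ _ hv
      have h2 := hbd _ _ hw
      have hle : v.2.2.succ ≤ w.2.2.castSucc := by
        rw [Fin.le_def]; simpa using hk
      have h3 := hg hle
      have h4 := hh hle
      simp only [point, Fin.lt_def] at h1 h2 hb
      omega
    · rw [← hk] at hw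
      have := (hS _).structure.2.2.1 _ hv _ hw
      rw [Fin.lt_def] at hb1 hb2
      simp only [PathLE, point, hk] at this
      omega

/-- Every set without diagonal pairs lies in a union of paths. -/
theorem exists_isUnionOfPaths_superset {m n r : ℕ} (hm : 0 < m) (hn : 0 < n) (hr : 0 < r)
    (s : Finset (Var m n r)) (hs : ∀ v ∈ s, ∀ w ∈ s, ¬ IsDiagonalPair v w) :
    ∃ F, IsUnionOfPaths m n r F ∧ s.image point ⊆ F := by
  simp only [isDiagonalPair_iff] at hs
  have corners : ∀ (N : ℕ) (_ : 0 < N) (c : Var m n r → ℕ) (_ : ∀ v, 1 ≤ c v ∧ c v ≤ N)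
      (_ : ∀ v ∈ s, ∀ w ∈ s, v.2.2 < w.2.2 → c w ≤ c v), ∃ g : Fin (r + 1) → ℕ,
      Antitone g ∧ g 0 = N ∧ g (Fin.last r) = 1 ∧
      ∀ v ∈ s, g v.2.2.succ ≤ c v ∧ c v ≤ g v.2.2.castSucc := by
    intro N hN c hc hmono
    -- The corner is the largest coordinate occurring in block `k` or later; the `max` with 1 covers
    -- the empty supremum 0, in particular at `k = r`. The value at 0 is overridden by `N`.
    set G : ℕ → ℕ := fun k => max 1 ((s.filter fun v => k ≤ (v.2.2 : ℕ)).sup c) with hG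
    have hGN : ∀ k, G k ≤ N := fun k =>
      max_le hN (Finset.sup_le fun v _ => (hc v).2)
    have hGanti : ∀ a b, a ≤ b → G b ≤ G a := fun a b hab =>
      max_le_max le_rfl (Finset.sup_mono fun v hv => by
        simp only [Finset.mem_filter] at hv ⊢
        exact ⟨hv.1, hab.trans hv.2⟩)
    have hr0 : (Fin.last r) ≠ 0 := by
      rw [Ne, Fin.ext_iff]; simp; omega
    refine ⟨fun k => if k = 0 then N else G k, ?_, by simp, ?_, ?_⟩
    · intro a b hab
      by_cases ha : a = 0
      · by_cases hb : b = 0 <;> simp [ha, hb, hGN]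
      · have hb : b ≠ 0 := by
          rintro rfl
          exact ha (le_antisymm hab (Fin.zero_le _))
        simp only [ha, hb, if_false]
        exact hGanti _ _ hab
    · simp only [hr0, if_false, Fin.val_last, hG]
      rw [Finset.filter_false_of_mem]
      · simp
      · intro v _
        have := v.2.2.2
        omega
    · intro v hv
      refine ⟨?_, ?_⟩
      · simp only [Fin.succ_ne_zero, if_false, Fin.val_succ]
        refine max_le (hc v).1 (Finset.sup_le fun w hw => ?_)
        simp only [Finset.mem_filter] at hw
        exact hmono v hv w hw.1 (by rw [Fin.lt_def]; omega)
      · dsimp only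
        split_ifs
        · exact (hc v).2
        · exact le_max_of_le_right
            (Finset.le_sup (f := c) (Finset.mem_filter.2 ⟨hv, by simp⟩))
  obtain ⟨g, hg, hg0, hg1, hgs⟩ := corners m hm (fun v => (v.1 : ℕ) + 1)
    (fun v => ⟨by omega, v.1.2⟩) (fun v hv w hw hk => by
      have := hs v hv w hw
      simp only [Fin.lt_def] at *
      omega)
  obtain ⟨h, hh, hh0, hh1, hhs⟩ := corners n hn (fun v => (v.2.1 : ℕ) + 1)
    (fun v => ⟨by omega, v.2.1.2⟩) (fun v hv w hw hk => by
      have := hs v hv w hw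
      simp only [Fin.lt_def] at *
      omega)
  have hpaths : ∀ k : Fin r, ∃ T, IsPath (g k.castSucc, (k : ℕ) * n + h k.succ)
      (g k.succ, (k : ℕ) * n + h k.castSucc) T ∧ (s.filter fun v => v.2.2 = k).image point ⊆ T := by
    intro k
    have hgk := hg (Fin.castSucc_lt_succ (i := k)).le
    have hhk := hh (Fin.castSucc_lt_succ (i := k)).le
    refine exists_isPath_superset
      (g k.castSucc + h k.castSucc - g k.succ - h k.succ) ?_ _ ?_ ?_ ?_
    · simp only [PathLE]; omega
    · simp only; omega
    · simp only [Finset.mem_image, Finset.mem_filter]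
      rintro _ ⟨v, ⟨hv, rfl⟩, rfl⟩
      have h1 := hgs v hv
      have h2 := hhs v hv
      simp only [PathLE, point]; omega
    · simp only [Finset.mem_image, Finset.mem_filter]
      rintro _ ⟨v, ⟨hv, rfl⟩, rfl⟩ _ ⟨w, ⟨hw, hwv⟩, rfl⟩
      have h1 := hs v hv w hw
      have h2 := hs w hw v hv
      simp only [hwv, true_and, lt_irrefl, false_and, false_or, Fin.lt_def] at h1 h2
      simp only [PathLE, point, hwv]; omega
  choose T hT hsT using hpaths
  refine ⟨_, ⟨g, h, hg, hg0, hg1, hh, hh0, hh1, T, hT, rfl⟩, fun x hx => ?_⟩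
  obtain ⟨v, hv, rfl⟩ := Finset.mem_image.1 hx
  exact Finset.mem_biUnion.2 ⟨v.2.2, Finset.mem_univ _,
    hsT _ (Finset.mem_image_of_mem _ (Finset.mem_filter.2 ⟨hv, rfl⟩))⟩

/-! ### Exponents and their marginals -/

/-- If an upper condition and a lower condition are nested on the support of `c`, the weight of
their conjunction is the smaller of the two weights. -/
theorem sum_and_eq_min {V : Type*} [Fintype V] (c : V → ℕ) (P Q : V → Prop) [DecidablePred P]
    [DecidablePred Q] (h : ∀ v w, c v ≠ 0 → c w ≠ 0 → P v → ¬ Q v → Q w → P w) :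
    ∑ v with P v ∧ Q v, c v = min (∑ v with P v, c v) (∑ v with Q v, c v) := by
  simp only [Finset.sum_filter]
  by_cases hPQ : ∀ v, c v ≠ 0 → P v → Q v
  · have h1 : ∀ v, (if P v ∧ Q v then c v else 0) = if P v then c v else 0 := by
      intro v
      have := hPQ v
      split_ifs <;> tauto
    have h2 : ∀ v, (if P v then c v else 0) ≤ if Q v then c v else 0 := by
      intro v
      have := hPQ v
      split_ifs <;> grind
    simp only [h1]
    exact (min_eq_left (Finset.sum_le_sum fun v _ => h2 v)).symm
  · push Not at hPQ
    obtain ⟨v, hv, hvP, hvQ⟩ := hPQ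
    have h1 : ∀ w, (if P w ∧ Q w then c w else 0) = if Q w then c w else 0 := by
      intro w
      have := h v w hv
      split_ifs <;> tauto
    have h2 : ∀ w, (if Q w then c w else 0) ≤ if P w then c w else 0 := by
      intro w
      have := h v w hv
      split_ifs <;> grind
    simp only [h1]
    exact (min_eq_right (Finset.sum_le_sum fun w _ => h2 w)).symm

/-- The weight of the fibres of `f` determines the weight of every union of fibres. -/
theorem sum_filter_comp_congr {V α : Type*} [Fintype V] [Fintype α] [DecidableEq α] (f : V → α)
    {c c' : V → ℕ} (h : ∀ a, ∑ v with f v = a, c v = ∑ v with f v = a, c' v)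
    (P : α → Prop) [DecidablePred P] : ∑ v with P (f v), c v = ∑ v with P (f v), c' v := by
  have key : ∀ d : V → ℕ, ∑ v with P (f v), d v = ∑ a with P a, ∑ v with f v = a, d v := by
    intro d
    simp only [Finset.sum_filter]
    simp only [← Finset.sum_filter P]
    rw [Finset.sum_comm]
    refine Finset.sum_congr rfl fun v _ => ?_
    rw [Finset.sum_filter, Finset.sum_eq_single (f v)]
    · simp
    · intro b _ hb; simp [hb.symm]
    · simp
  rw [key, key]
  exact Finset.sum_congr rfl fun a _ => h a

/-- The joint distribution of two oppositely ordered functions is determined by the marginals. -/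
theorem joint_eq_of_marginals_eq {V α β : Type*} [Fintype V] [Fintype α] [Fintype β]
    [LinearOrder α] [LinearOrder β] (f : V → α) (g : V → β) {c c' : V → ℕ}
    (hc : ∀ v w, c v ≠ 0 → c w ≠ 0 → g v < g w → f w ≤ f v)
    (hc' : ∀ v w, c' v ≠ 0 → c' w ≠ 0 → g v < g w → f w ≤ f v)
    (hf : ∀ a, ∑ v with f v = a, c v = ∑ v with f v = a, c' v)
    (hg : ∀ b, ∑ v with g v = b, c v = ∑ v with g v = b, c' v) (a : α) (b : β) :
    ∑ v with f v = a ∧ g v = b, c v = ∑ v with f v = a ∧ g v = b, c' v := by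
  have step : ∀ (P : α → Prop) (Q : β → Prop) [DecidablePred P] [DecidablePred Q],
      (∀ x y, x ≤ y → P x → P y) → (∀ x y, x ≤ y → Q y → Q x) →
      ∑ v with P (f v) ∧ Q (g v), c v = ∑ v with P (f v) ∧ Q (g v), c' v := by
    intro P Q _ _ hP hQ
    have nested : ∀ d : V → ℕ, (∀ v w, d v ≠ 0 → d w ≠ 0 → g v < g w → f w ≤ f v) →
        ∀ v w, d v ≠ 0 → d w ≠ 0 → P (f v) → ¬ Q (g v) → Q (g w) → P (f w) := by
      intro d hd v w hv hw hPv hQv hQw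
      refine hP _ _ (hd w v hw hv ?_) hPv
      by_contra hlt
      exact hQv (hQ _ _ (not_lt.1 hlt) hQw)
    rw [sum_and_eq_min c (fun v => P (f v)) (fun v => Q (g v)) (nested c hc),
      sum_and_eq_min c' (fun v => P (f v)) (fun v => Q (g v)) (nested c' hc'),
      sum_filter_comp_congr f hf, sum_filter_comp_congr g hg]
  -- Inclusion–exclusion: the indicator of a point is (1[a ≤ f] - 1[a < f]) (1[g ≤ b] - 1[g < b]),
  -- with the negative terms moved across.
  have split : ∀ d : V → ℕ, ∑ v with a ≤ f v ∧ g v ≤ b, d v + ∑ v with a < f v ∧ g v < b, d v =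
      ∑ v with f v = a ∧ g v = b, d v +
        (∑ v with a < f v ∧ g v ≤ b, d v + ∑ v with a ≤ f v ∧ g v < b, d v) := by
    intro d
    simp only [Finset.sum_filter, ← Finset.sum_add_distrib]
    refine Finset.sum_congr rfl fun v _ => ?_
    grind
  have s1 := split c
  have s2 := split c'
  rw [step (fun x => a ≤ x) (fun y => y ≤ b) (fun _ _ h h' => h'.trans h)
      (fun _ _ h h' => h.trans h'),
    step (fun x => a < x) (fun y => y < b) (fun _ _ h h' => h'.trans_le h)
      (fun _ _ h h' => h.trans_lt h'),
    step (fun x => a < x) (fun y => y ≤ b) (fun _ _ h h' => h'.trans_le h)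
      (fun _ _ h h' => h.trans h'),
    step (fun x => a ≤ x) (fun y => y < b) (fun _ _ h h' => h'.trans h)
      (fun _ _ h h' => h.trans_lt h')] at s1
  omega

/-- An exponent without diagonal pairs in its support is determined by its three marginals. -/
theorem eq_of_marginals_eq {m n r : ℕ} {c c' : Var m n r → ℕ}
    (hc : ∀ v w, c v ≠ 0 → c w ≠ 0 → ¬ IsDiagonalPair v w)
    (hc' : ∀ v w, c' v ≠ 0 → c' w ≠ 0 → ¬ IsDiagonalPair v w)
    (h1 : ∀ a, ∑ v with v.1 = a, c v = ∑ v with v.1 = a, c' v)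
    (h2 : ∀ a, ∑ v with v.2.1 = a, c v = ∑ v with v.2.1 = a, c' v)
    (h3 : ∀ a, ∑ v with v.2.2 = a, c v = ∑ v with v.2.2 = a, c' v) : c = c' := by
  simp only [isDiagonalPair_iff, not_or, not_and, not_lt] at hc hc'
  have h13 := joint_eq_of_marginals_eq (fun v : Var m n r => v.1) (fun v => v.2.2)
    (fun v w hv hw h => ((hc v w hv hw).1 h).1) (fun v w hv hw h => ((hc' v w hv hw).1 h).1) h1 h3
  have h23 := joint_eq_of_marginals_eq (fun v : Var m n r => v.2.1) (fun v => v.2.2)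
    (fun v w hv hw h => ((hc v w hv hw).1 h).2) (fun v w hv hw h => ((hc' v w hv hw).1 h).2) h2 h3
  funext u
  obtain ⟨i, j, k⟩ := u
  have block : ∀ d : Var m n r → ℕ,
      (∀ v w, d v ≠ 0 → d w ≠ 0 → (v.2.2 < w.2.2 → w.1 ≤ v.1 ∧ w.2.1 ≤ v.2.1) ∧
        (v.2.2 = w.2.2 → v.1 < w.1 → w.2.1 ≤ v.2.1)) →
      ∀ v w, (if v.2.2 = k then d v else 0) ≠ 0 → (if w.2.2 = k then d w else 0) ≠ 0 →
        v.2.1 < w.2.1 → w.1 ≤ v.1 := by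
    intro d hd v w hv hw hlt
    simp only [ne_eq, ite_eq_right_iff, Classical.not_imp] at hv hw
    by_contra hcon
    exact absurd ((hd v w hv.2 hw.2).2 (hv.1.trans hw.1.symm) (not_le.1 hcon)) (not_le.2 hlt)
  -- Inside block `k` rows and columns are oppositely ordered, and the joint distributions with the
  -- block index serve as marginals.
  have := joint_eq_of_marginals_eq (fun v : Var m n r => v.1) (fun v => v.2.1)
    (c := fun v => if v.2.2 = k then c v else 0) (c' := fun v => if v.2.2 = k then c' v else 0)
    (block c hc) (block c' hc')
    (fun a => by simpa only [← Finset.sum_filter, Finset.filter_filter] using h13 a k)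
    (fun a => by simpa only [← Finset.sum_filter, Finset.filter_filter] using h23 a k) i j
  simp only [← Finset.sum_filter, Finset.filter_filter] at this
  have huniq : (Finset.univ.filter fun v : Var m n r => (v.1 = i ∧ v.2.1 = j) ∧ v.2.2 = k) =
      {(i, j, k)} := by
    ext ⟨x, y, z⟩
    simp [and_assoc]
  simpa [huniq] using this

/-! ### The Segre parametrization -/

/-- The variables of the ring in which `a_i b_j c_k` parametrizes the rank one tensors. -/
abbrev SegreVar (m n r : ℕ) : Type := Fin m ⊕ Fin n ⊕ Fin r

/-- The exponent of the monomial `a_i b_j c_k`. -/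
noncomputable def segreWeight {m n r : ℕ} (v : Var m n r) : SegreVar m n r →₀ ℕ :=
  Finsupp.single (Sum.inl v.1) 1 + Finsupp.single (Sum.inr (Sum.inl v.2.1)) 1 +
    Finsupp.single (Sum.inr (Sum.inr v.2.2)) 1

/-- The parametrization `x_{ij}^k ↦ a_i b_j c_k` of the Segre variety. -/
noncomputable def segreHom (K : Type*) [Field K] (m n r : ℕ) :
    MvPolynomial (Var m n r) K →ₐ[K] MvPolynomial (SegreVar m n r) K :=
  aeval fun v => X (Sum.inl v.1) * X (Sum.inr (Sum.inl v.2.1)) * X (Sum.inr (Sum.inr v.2.2))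

/-- The effect of `segreHom` on exponents. -/
noncomputable def segreExponent {m n r : ℕ} (c : Var m n r →₀ ℕ) : SegreVar m n r →₀ ℕ :=
  c.sum fun v e => e • segreWeight v

theorem segreHom_monomial (K : Type*) [Field K] {m n r : ℕ} (c : Var m n r →₀ ℕ) (a : K) :
    segreHom K m n r (monomial c a) = monomial (segreExponent c) a := by
  rw [segreHom, aeval_monomial, segreExponent, monomial_finsupp_sum_index]
  congr 1
  refine Finsupp.prod_congr fun v _ => ?_
  rw [← one_pow (M := K) (c v), ← monomial_pow]
  simp [segreWeight, X, monomial_mul]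

theorem segreExponent_apply {m n r : ℕ} (c : Var m n r →₀ ℕ) (x : SegreVar m n r) :
    segreExponent c x = ∑ v, c v * segreWeight v x := by
  rw [segreExponent, Finsupp.sum_fintype _ _ (by simp), Finsupp.finsetSum_apply]
  simp

/-- The exponents of the a_i, b_j and c_k in the image are the three marginals. -/
theorem eq_of_segreExponent_eq {m n r : ℕ} {c c' : Var m n r →₀ ℕ}
    (hc : ∀ v w, c v ≠ 0 → c w ≠ 0 → ¬ IsDiagonalPair v w)
    (hc' : ∀ v w, c' v ≠ 0 → c' w ≠ 0 → ¬ IsDiagonalPair v w)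
    (h : segreExponent c = segreExponent c') : c = c' := by
  have h' : ∀ x, ∑ v, c v * segreWeight v x = ∑ v, c' v * segreWeight v x := fun x => by
    rw [← segreExponent_apply, ← segreExponent_apply, h]
  refine DFunLike.coe_injective (eq_of_marginals_eq hc hc' (fun a => ?_) (fun a => ?_) fun a => ?_)
  · simpa [segreWeight, Finsupp.single_apply, Finset.sum_filter] using h' (Sum.inl a)
  · simpa [segreWeight, Finsupp.single_apply, Finset.sum_filter] using h' (Sum.inr (Sum.inl a))
  · simpa [segreWeight, Finsupp.single_apply, Finset.sum_filter] using h' (Sum.inr (Sum.inr a))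

/-- `segreHom` is injective on polynomials all of whose monomials avoid the diagonal pairs. -/
theorem eq_zero_of_segreHom_eq_zero {K : Type*} [Field K] {m n r : ℕ}
    {f : MvPolynomial (Var m n r) K}
    (hf : ∀ c ∈ f.support, ∀ v w, c v ≠ 0 → c w ≠ 0 → ¬ IsDiagonalPair v w)
    (h : segreHom K m n r f = 0) : f = 0 := by
  by_contra hne
  obtain ⟨c, hc⟩ := Finset.nonempty_iff_ne_empty.2 (mt support_eq_empty.1 hne)
  have h1 : coeff (segreExponent c) (segreHom K m n r f) = coeff c f := by
    conv_lhs => rw [f.as_sum]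
    simp only [map_sum, segreHom_monomial, coeff_sum, coeff_monomial]
    rw [Finset.sum_eq_single c]
    · simp
    · intro c' hc' hcc'
      rw [if_neg fun h => hcc' (eq_of_segreExponent_eq (hf _ hc') (hf _ hc) h)]
    · exact fun h => absurd hc h
  rw [h, coeff_zero] at h1
  exact mem_support_iff.1 hc h1.symm

/-- Both concatenations become matrices of rank at most one. -/
theorem segreHom_doubleDetIdeal {K : Type*} [Field K] {m n r : ℕ}
    {f : MvPolynomial (Var m n r) K} (hf : f ∈ doubleDetIdeal K m n r) :
    segreHom K m n r f = 0 := by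
  have hle : doubleDetIdeal K m n r ≤ RingHom.ker (segreHom K m n r) := by
    rw [doubleDetIdeal, Ideal.span_le]
    rintro _ (⟨a, a', b, b', -, -, rfl⟩ | ⟨a, a', b, b', -, -, rfl⟩)
    · simp only [SetLike.mem_coe, RingHom.mem_ker, Matrix.det_fin_two, horizontal, segreHom]
      simp
      ring
    · simp only [SetLike.mem_coe, RingHom.mem_ker, Matrix.det_fin_two, vertical, segreHom]
      simp
      ring
  exact hle hf

/-! ### The initial ideal -/

/-- Every diagonal pair is the leading term of an element of the double determinantal ideal. -/
theorem exists_mem_leadingTerm_eq {K : Type*} [Field K] {m n r : ℕ}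
    {ord : MonomialOrder (Var m n r)} (hord : IsDiagonal K ord) {v w : Var m n r}
    (hvw : IsDiagonalPair v w) :
    ∃ f ∈ doubleDetIdeal K m n r, ord.leadingTerm f = X v * X w := by
  rcases hvw with ⟨h1, h2⟩ | ⟨h1, h2⟩
  · exact ⟨_, Ideal.subset_span (Or.inl ⟨_, _, _, _, h1, h2, rfl⟩), hord.1 _ _ _ _ h1 h2⟩
  · exact ⟨_, Ideal.subset_span (Or.inr ⟨_, _, _, _, h2, h1, rfl⟩), hord.2 _ _ _ _ h2 h1⟩

theorem X_mul_X_eq_monomial {σ R : Type*} [CommSemiring R] (v w : σ) :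
    (X v * X w : MvPolynomial σ R) = monomial (Finsupp.single v 1 + Finsupp.single w 1) 1 := by
  simp [X, monomial_mul]

theorem degree_eq_of_leadingTerm_eq {σ K : Type*} [Field K] {ord : MonomialOrder σ}
    {f : MvPolynomial σ K} {v w : σ} (h : ord.leadingTerm f = X v * X w) :
    ord.degree f = Finsupp.single v 1 + Finsupp.single w 1 ∧ ord.leadingCoeff f = 1 := by
  rw [X_mul_X_eq_monomial] at h
  rw [← ord.degree_leadingTerm, ← ord.leadingCoeff_leadingTerm, h]
  classical
  simp [ord.degree_monomial]

/-- Two distinct variables divide a monomial iff their product does. -/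
theorem single_add_single_le_iff {σ : Type*} {v w : σ} (hvw : v ≠ w) (c : σ →₀ ℕ) :
    Finsupp.single v 1 + Finsupp.single w 1 ≤ c ↔ c v ≠ 0 ∧ c w ≠ 0 := by
  classical
  constructor
  · intro h
    have h1 := h v
    have h2 := h w
    simp [hvw, hvw.symm] at h1 h2
    omega
  · rintro ⟨h1, h2⟩ x
    simp only [Finsupp.coe_add, Pi.add_apply, Finsupp.single_apply]
    split_ifs with h3 h4 h4
    · exact absurd (h3.trans h4.symm) hvw
    · subst h3; omega
    · subst h4; omega
    · omega

theorem IsDiagonalPair.ne {m n r : ℕ} {v w : Var m n r} (h : IsDiagonalPair v w) : v ≠ w := by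
  rintro rfl
  simp [isDiagonalPair_iff] at h

/-- The leading monomial of a nonzero element of the double determinantal ideal is divisible by
a diagonal pair. -/
theorem exists_isDiagonalPair_of_mem {K : Type*} [Field K] {m n r : ℕ}
    {ord : MonomialOrder (Var m n r)} (hord : IsDiagonal K ord)
    {f : MvPolynomial (Var m n r) K} (hf : f ∈ doubleDetIdeal K m n r) (hf0 : f ≠ 0) :
    ∃ v w, IsDiagonalPair v w ∧ Finsupp.single v 1 + Finsupp.single w 1 ≤ ord.degree f := by
  set B : Set (MvPolynomial (Var m n r) K) :=
    {b | b ∈ doubleDetIdeal K m n r ∧ ∃ v w, IsDiagonalPair v w ∧ ord.leadingTerm b = X v * X w}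
    with hB
  obtain ⟨g, rem, hfg, hdeg, hrem⟩ := ord.div_set (B := B) (fun b hb => by
    obtain ⟨-, v, w, -, h⟩ := hb
    rw [(degree_eq_of_leadingTerm_eq h).2]
    exact isUnit_one) f
  have hlc : Finsupp.linearCombination _ (fun b : B => (b : MvPolynomial (Var m n r) K)) g ∈
      doubleDetIdeal K m n r := by
    rw [Finsupp.linearCombination_apply]
    exact Ideal.sum_mem _ fun b _ => Ideal.mul_mem_left _ _ b.2.1
  have hrem0 : rem = 0 := by
    refine eq_zero_of_segreHom_eq_zero (fun c hc v w hv hw hvw => ?_) ?_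
    · obtain ⟨b, hb, hbl⟩ := exists_mem_leadingTerm_eq hord hvw
      refine hrem c hc b ⟨hb, v, w, hvw, hbl⟩ ?_
      rw [(degree_eq_of_leadingTerm_eq hbl).1, single_add_single_le_iff hvw.ne]
      exact ⟨hv, hw⟩
    · have := segreHom_doubleDetIdeal hf
      rwa [hfg, map_add, segreHom_doubleDetIdeal hlc, zero_add] at this
  rw [hrem0, add_zero, Finsupp.linearCombination_apply, Finsupp.sum] at hfg
  have hcoeff : coeff (ord.degree f) f ≠ 0 := ord.leadingCoeff_ne_zero_iff.2 hf0
  -- The leading monomial of `f` survives in some summand; the degree bound from division makes it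
  -- the leading monomial of that summand.
  obtain ⟨b, -, hb⟩ : ∃ b ∈ g.support, coeff (ord.degree f) (g b • (b : MvPolynomial _ K)) ≠ 0 := by
    by_contra! hcon
    refine hcoeff ?_
    conv_lhs => rw [hfg]
    rw [coeff_sum]
    exact Finset.sum_eq_zero fun b hb => by rw [← hfg]; exact hcon b hb
  rw [smul_eq_mul, mul_comm] at hb
  have hle := ord.le_degree (mem_support_iff.2 hb)
  have heq : ord.degree f = ord.degree ((b : MvPolynomial _ K) * g b) :=
    ord.toSyn.injective (le_antisymm hle (hdeg b))
  have hne : (b : MvPolynomial _ K) * g b ≠ 0 := by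
    intro h0
    rw [h0, coeff_zero] at hb
    exact hb rfl
  obtain ⟨-, v, w, hvw, hl⟩ := b.2
  refine ⟨v, w, hvw, ?_⟩
  rw [heq, ord.degree_mul (left_ne_zero_of_mul hne) (right_ne_zero_of_mul hne),
    (degree_eq_of_leadingTerm_eq hl).1]
  exact le_self_add

theorem initialIdeal_doubleDetIdeal {K : Type*} [Field K] {m n r : ℕ}
    {ord : MonomialOrder (Var m n r)} (hord : IsDiagonal K ord) :
    initialIdeal ord (doubleDetIdeal K m n r) =
      Ideal.span ((fun c => monomial c (1 : K)) ''
        {c | ∃ v w, IsDiagonalPair v w ∧ c = Finsupp.single v 1 + Finsupp.single w 1}) := by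
  refine le_antisymm (Ideal.span_le.2 ?_) (Ideal.span_le.2 ?_)
  · rintro _ ⟨f, hf, rfl⟩
    rw [SetLike.mem_coe, mem_ideal_span_monomial_image]
    intro c hc
    have hf0 : f ≠ 0 := by
      rintro rfl
      simp at hc
    obtain ⟨v, w, hvw, hle⟩ := exists_isDiagonalPair_of_mem hord hf hf0
    refine ⟨_, ⟨v, w, hvw, rfl⟩, ?_⟩
    rw [MonomialOrder.leadingTerm] at hc
    have := support_monomial_subset hc
    rw [Finset.mem_singleton] at this
    rwa [this]
  · rintro _ ⟨_, ⟨v, w, hvw, rfl⟩, rfl⟩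
    obtain ⟨f, hf, hl⟩ := exists_mem_leadingTerm_eq hord hvw
    refine Ideal.subset_span ⟨f, hf, ?_⟩
    rw [hl, X_mul_X_eq_monomial]

/-! ### Stanley–Reisner ideals -/

/-- The exponent of a squarefree monomial. -/
noncomputable def indicatorExponent {σ : Type*} (s : Finset σ) : σ →₀ ℕ :=
  ∑ v ∈ s, Finsupp.single v 1

theorem indicatorExponent_apply {σ : Type*} [DecidableEq σ] (s : Finset σ) (v : σ) :
    indicatorExponent s v = if v ∈ s then 1 else 0 := by
  simp [indicatorExponent, Finsupp.finsetSum_apply, Finsupp.single_apply]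

theorem prod_X_eq_monomial {σ R : Type*} [CommSemiring R] (s : Finset σ) :
    (∏ v ∈ s, X v : MvPolynomial σ R) = monomial (indicatorExponent s) 1 := by
  simp [indicatorExponent, X, monomial_sum_one]

theorem indicatorExponent_le_iff {σ : Type*} (s : Finset σ) (c : σ →₀ ℕ) :
    indicatorExponent s ≤ c ↔ ∀ v ∈ s, c v ≠ 0 := by
  classical
  constructor
  · intro h v hv
    have := h v
    rw [indicatorExponent_apply, if_pos hv] at this
    omega
  · intro h v
    rw [indicatorExponent_apply]
    split_ifs with hv
    · exact Nat.pos_of_ne_zero (h v hv)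
    · exact Nat.zero_le _

theorem indicatorExponent_ne_zero_iff {σ : Type*} (s : Finset σ) (v : σ) :
    indicatorExponent s v ≠ 0 ↔ v ∈ s := by
  classical
  simp [indicatorExponent_apply]

theorem stanleyReisnerIdeal_eq_span {σ K : Type*} [Field K] (D : PreAbstractSimplicialComplex σ) :
    stanleyReisnerIdeal K D = Ideal.span ((fun c => monomial c (1 : K)) ''
      {c | ∃ s : Finset σ, s.Nonempty ∧ s ∉ D.faces ∧ c = indicatorExponent s}) := by
  rw [stanleyReisnerIdeal]
  congr 1
  ext f
  constructor
  · rintro ⟨s, hs, hsD, rfl⟩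
    exact ⟨_, ⟨s, hs, hsD, rfl⟩, (prod_X_eq_monomial s).symm⟩
  · rintro ⟨_, ⟨s, hs, hsD, rfl⟩, rfl⟩
    exact ⟨s, hs, hsD, (prod_X_eq_monomial s).symm⟩

/-- A squarefree monomial lies in the Stanley–Reisner ideal iff its support is not a face. -/
theorem monomial_mem_stanleyReisnerIdeal_iff {σ K : Type*} [Field K]
    (D : PreAbstractSimplicialComplex σ) {s : Finset σ} (hs : s.Nonempty) :
    monomial (indicatorExponent s) (1 : K) ∈ stanleyReisnerIdeal K D ↔ s ∉ D.faces := by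
  classical
  rw [stanleyReisnerIdeal_eq_span, mem_ideal_span_monomial_image]
  simp only [support_monomial, one_ne_zero, if_false, Finset.mem_singleton, forall_eq]
  constructor
  · rintro ⟨_, ⟨t, ht, htD, rfl⟩, hle⟩ hsD
    simp only [indicatorExponent_le_iff, indicatorExponent_ne_zero_iff] at hle
    exact htD ((D.isRelLowerSet_faces hsD).2 hle ht)
  · exact fun h => ⟨_, ⟨s, hs, h, rfl⟩, le_rfl⟩

/-- The complex of the sets without diagonal pairs. -/
def diagonalFreeComplex (m n r : ℕ) : PreAbstractSimplicialComplex (Var m n r) where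
  faces := {s | s.Nonempty ∧ ∀ v ∈ s, ∀ w ∈ s, ¬ IsDiagonalPair v w}
  isRelLowerSet_faces := fun _ hs =>
    ⟨hs.1, fun _ hts ht => ⟨ht, fun v hv w hw => hs.2 v (hts hv) w (hts hw)⟩⟩

theorem stanleyReisnerIdeal_diagonalFreeComplex (K : Type*) [Field K] (m n r : ℕ) :
    stanleyReisnerIdeal K (diagonalFreeComplex m n r) =
      Ideal.span ((fun c => monomial c (1 : K)) ''
        {c | ∃ v w, IsDiagonalPair v w ∧ c = Finsupp.single v 1 + Finsupp.single w 1}) := by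
  classical
  rw [stanleyReisnerIdeal_eq_span]
  refine le_antisymm (Ideal.span_le.2 ?_) (Ideal.span_le.2 ?_)
  · rintro _ ⟨_, ⟨s, hs, hsD, rfl⟩, rfl⟩
    have : ∃ v ∈ s, ∃ w ∈ s, IsDiagonalPair v w := by
      by_contra! hcon
      exact hsD ⟨hs, hcon⟩
    obtain ⟨v, hv, w, hw, hvw⟩ := this
    rw [SetLike.mem_coe, mem_ideal_span_monomial_image]
    simp only [support_monomial, one_ne_zero, if_false, Finset.mem_singleton, forall_eq]
    refine ⟨_, ⟨v, w, hvw, rfl⟩, ?_⟩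
    simp only [single_add_single_le_iff hvw.ne, indicatorExponent_ne_zero_iff]
    exact ⟨hv, hw⟩
  · rintro _ ⟨_, ⟨v, w, hvw, rfl⟩, rfl⟩
    refine Ideal.subset_span ⟨_, ⟨{v, w}, by simp, fun h => ?_, rfl⟩, ?_⟩
    · exact h.2 v (by simp) w (by simp) hvw
    · simp only [indicatorExponent, Finset.sum_pair hvw.ne]

/-- The nonempty faces are read off from the squarefree monomials outside the ideal. -/
theorem stanleyReisnerIdeal_injective {σ : Type*} (K : Type*) [Field K] :
    Function.Injective (stanleyReisnerIdeal (σ := σ) K) := by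
  intro D D' h
  ext s
  have key : ∀ E : PreAbstractSimplicialComplex σ,
      s ∈ E.faces ↔ s.Nonempty ∧ monomial (indicatorExponent s) (1 : K) ∉ stanleyReisnerIdeal K E :=
    fun E => ⟨fun hs => ⟨(E.isRelLowerSet_faces hs).1, fun hmem =>
      (monomial_mem_stanleyReisnerIdeal_iff E (E.isRelLowerSet_faces hs).1).1 hmem hs⟩,
      fun ⟨hs, hmem⟩ => by
        rwa [monomial_mem_stanleyReisnerIdeal_iff E hs, not_not] at hmem⟩
  rw [key, key, h]

/-! ### Facets -/

theorem isFacet_diagonalFreeComplex_iff {m n r : ℕ} (hm : 0 < m) (hn : 0 < n) (hr : 0 < r)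
    (F : Finset (ℕ × ℕ)) :
    IsFacet ((diagonalFreeComplex m n r).map point) F ↔ IsUnionOfPaths m n r F := by
  have hface : ∀ U, IsUnionOfPaths m n r U →
      U ∈ ((diagonalFreeComplex m n r).map point).faces := by
    intro U hU
    obtain ⟨s, hs, hsD, rfl⟩ := hU.exists_image hr
    exact ⟨s, ⟨hs, hsD⟩, rfl⟩
  have hsup : ∀ G ∈ ((diagonalFreeComplex m n r).map point).faces,
      ∃ U, IsUnionOfPaths m n r U ∧ G ⊆ U := by
    rintro _ ⟨s, hs, rfl⟩
    exact exists_isUnionOfPaths_superset hm hn hr s hs.2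
  constructor
  · intro hF
    obtain ⟨U, hU, hFU⟩ := hsup F hF.1
    rwa [hF.eq_of_le (hface U hU) hFU]
  · intro hF
    refine ⟨hface F hF, fun G hG hFG => ?_⟩
    obtain ⟨U, hU, hGU⟩ := hsup G hG
    -- Equal cardinalities make the nested unions of paths `F ⊆ U` coincide.
    rw [Finset.eq_of_subset_of_card_le (hFG.trans hGU) (by rw [hU.card, hF.card])]
    exact hGU

end DoubleDet

theorem mainTheorem9 (K : Type*) [Field K] (m n r : ℕ) (hm : 0 < m) (hn : 0 < n) (hr : 0 < r)
    (ord : MonomialOrder (DoubleDet.Var m n r)) (hord : DoubleDet.IsDiagonal K ord) :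
    (∃! D : PreAbstractSimplicialComplex (DoubleDet.Var m n r),
      DoubleDet.stanleyReisnerIdeal K D =
        DoubleDet.initialIdeal ord (DoubleDet.doubleDetIdeal K m n r)) ∧
    ∀ D : PreAbstractSimplicialComplex (DoubleDet.Var m n r),
      DoubleDet.stanleyReisnerIdeal K D =
        DoubleDet.initialIdeal ord (DoubleDet.doubleDetIdeal K m n r) →
      (∀ F : Finset (ℕ × ℕ),
        DoubleDet.IsFacet (D.map DoubleDet.point) F ↔ DoubleDet.IsUnionOfPaths m n r F) ∧
      (∀ F : Finset (ℕ × ℕ),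
        DoubleDet.IsFacet (D.map DoubleDet.point) F → F.card = m + n + r - 2) := by
  have hD : DoubleDet.stanleyReisnerIdeal K (DoubleDet.diagonalFreeComplex m n r) =
      DoubleDet.initialIdeal ord (DoubleDet.doubleDetIdeal K m n r) := by
    rw [DoubleDet.stanleyReisnerIdeal_diagonalFreeComplex,
      DoubleDet.initialIdeal_doubleDetIdeal hord]
  have huniq : ∀ D : PreAbstractSimplicialComplex (DoubleDet.Var m n r),
      DoubleDet.stanleyReisnerIdeal K D =
        DoubleDet.initialIdeal ord (DoubleDet.doubleDetIdeal K m n r) →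
      D = DoubleDet.diagonalFreeComplex m n r := fun D h =>
    DoubleDet.stanleyReisnerIdeal_injective K (h.trans hD.symm)
  refine ⟨⟨_, hD, huniq⟩, fun D h => ?_⟩
  rw [huniq D h]
  have hfacet := DoubleDet.isFacet_diagonalFreeComplex_iff hm hn hr
  exact ⟨hfacet, fun F hF => ((hfacet F).1 hF).card⟩
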